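/- **Fully Online Bipartite Matching.** An instance consists of a finite bipartite graph (whose bipartition is not revealed) and a finite sequence of time steps in which each vertex $v$ has exactly one *arrival* step and, later, exactly one *deadline* step; for every edge $\{u,v\}$, both endpoints arrive before the deadline of either of them. The algorithm initially knows nothing about the instance. When $v$ arrives, $v$ and its edges to previously arrived vertices are revealed; a deadline becomes known to the algorithm only when it is reached. At the deadline of a vertex $v$ that is still unmatched, the algorithm must irrevocably either match $v$ to an unmatched neighbor whose deadline has not yet passed or leave $v$ unmatched; no other decisions are made (algorithms are lazy). The instance is fixed in advance by an oblivious adversary. For $c\in\mathbb R$, a randomized algorithm is *$c$-competitive* if for every instance the expected size (over its own random bits) of the matching it produces is at least $c$ times the size of a maximum matching of the graph. **Theorem.** If a randomized online algorithm is $c$-competitive for Fully Online Bipartite Matching, then $c\le 0.6317$. Moreover $$0.6317 \;<\; \tfrac{62}{63}-\tfrac67\,e^{-8/9} \;<\; 1-\tfrac1e ,$$ so no randomized algorithm has a competitive ratio better than $\tfrac{62}{63}-\tfrac67 e^{-8/9}\approx 0.631745$, and the best possible ratio is strictly below $1-\frac1e$. -/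

import Mathlib

open MeasureTheory

/-- A time step of the fully online model. Vertices are named by natural numbers. -/
inductive Step : Type
  | arrival (v : ℕ) : Step
  | deadline (v : ℕ) : Step

/-- An instance of Fully Online Matching, fixed in advance by the (oblivious) adversary: a finite
graph together with the order of the arrivals and deadlines of its vertices.
`[x, y] <+ timeline` says that step `x` comes before step `y`. -/
structure OnlineInstance where
  /-- the vertex set -/
  verts : Finset ℕ
  /-- the underlying graph, all of whose edges join vertices of `verts` -/
  graph : SimpleGraph ℕ
  mem_verts_of_adj : ∀ u v, graph.Adj u v → u ∈ verts ∧ v ∈ verts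
  /-- the sequence of time steps: every vertex has exactly one arrival and one deadline -/
  timeline : List Step
  nodup : timeline.Nodup
  arrival_mem_iff : ∀ v, Step.arrival v ∈ timeline ↔ v ∈ verts
  deadline_mem_iff : ∀ v, Step.deadline v ∈ timeline ↔ v ∈ verts
  arrival_before_deadline : ∀ v ∈ verts,
    List.Sublist [Step.arrival v, Step.deadline v] timeline
  /-- all edges at `v` are revealed before the deadline of `v` -/
  neighbor_before_deadline : ∀ u v, graph.Adj u v →
    List.Sublist [Step.arrival u, Step.deadline v] timeline

/-- The size of a maximum matching of the underlying graph. (The set is bounded because the graph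
has finitely many edges.) -/
noncomputable def OnlineInstance.opt (I : OnlineInstance) : ℕ :=
  sSup {m : ℕ | ∃ M : I.graph.Subgraph, M.IsMatching ∧ M.edgeSet.ncard = m}

/-- What an algorithm sees in a time step: on the arrival of `v`, the name `v` and the set of the
previously arrived neighbors of `v`; at a deadline, the vertex whose deadline it is. -/
inductive Observation : Type
  | arrival (v : ℕ) (neighbors : Finset ℕ) : Observation
  | deadline (v : ℕ) : Observation

/-- A deterministic (lazy) online algorithm: at the deadline of an unmatched vertex `v` it looks at
everything observed so far, the current deadline being the last entry of the list, and names the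
vertex to which `v` is to be matched (`some u`) or leaves `v` unmatched (`none`). Its earlier
decisions are determined by the earlier observations, so they need not be passed to it again. -/
abbrev DetAlgorithm : Type := List Observation → Option ℕ

/-- The situation during a run of an algorithm. -/
structure RunState where
  /-- the observations made so far, oldest first -/
  history : List Observation
  /-- the vertices that have arrived -/
  arrived : Finset ℕ
  /-- the vertices whose deadline has passed -/
  expired : Finset ℕ
  /-- the edges chosen so far -/
  matching : Finset (Sym2 ℕ)

/-- The situation before the first step. -/
def RunState.init : RunState := ⟨[], ∅, ∅, ∅⟩

/-- The vertex `v` is covered by the current matching. -/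
def RunState.Matched (s : RunState) (v : ℕ) : Prop := ∃ e ∈ s.matching, v ∈ e

/-- At the deadline of `v`, the edge `vu` may be chosen: `v` is unmatched, and `u` is an unmatched
neighbor of `v` that has arrived and whose own deadline has not passed. -/
def RunState.CanMatch (G : SimpleGraph ℕ) (s : RunState) (v u : ℕ) : Prop :=
  G.Adj v u ∧ u ∈ s.arrived ∧ u ∉ s.expired ∧ ¬ s.Matched v ∧ ¬ s.Matched u

open Classical in
/-- One time step of a run. A decision that is not permitted leaves the vertex unmatched. -/
noncomputable def RunState.next (G : SimpleGraph ℕ) (d : DetAlgorithm) (s : RunState) :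
    Step → RunState
  | Step.arrival v =>
      { history := s.history ++ [Observation.arrival v (s.arrived.filter (G.Adj v))]
        arrived := insert v s.arrived
        expired := s.expired
        matching := s.matching }
  | Step.deadline v =>
      { history := s.history ++ [Observation.deadline v]
        arrived := s.arrived
        expired := insert v s.expired
        matching :=
          match d (s.history ++ [Observation.deadline v]) with
          | none => s.matching
          | some u => if s.CanMatch G v u then insert s(v, u) s.matching else s.matching }

/-- The matching produced by a deterministic algorithm on an instance. -/
noncomputable def DetAlgorithm.output (d : DetAlgorithm) (I : OnlineInstance) :
    Finset (Sym2 ℕ) :=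
  (I.timeline.foldl (RunState.next I.graph d) RunState.init).matching

/-- A randomized online algorithm with random bits `ω` drawn from a probability space `Ω`: for every
`ω` a deterministic online algorithm, each of whose decisions depends measurably on `ω`. -/
structure RandomizedAlgorithm (Ω : Type*) [MeasurableSpace Ω] where
  μ : Measure Ω
  isProbabilityMeasure : IsProbabilityMeasure μ
  alg : Ω → DetAlgorithm
  measurableSet_alg : ∀ (h : List Observation) (o : Option ℕ), MeasurableSet {ω | alg ω h = o}

/-- The expected size of the matching produced on an instance. (The size is a measurable function
of `ω`, with finitely many values.) -/
noncomputable def RandomizedAlgorithm.expectedSize {Ω : Type*} [MeasurableSpace Ω]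
    (A : RandomizedAlgorithm Ω) (I : OnlineInstance) : ℝ :=
  ∫ ω, (((A.alg ω).output I).card : ℝ) ∂A.μ

/-- `A` is `c`-competitive for Fully Online Bipartite Matching. -/
def RandomizedAlgorithm.IsCompetitive {Ω : Type*} [MeasurableSpace Ω]
    (A : RandomizedAlgorithm Ω) (c : ℝ) : Prop :=
  ∀ I : OnlineInstance, I.graph.IsBipartite → c * (I.opt : ℝ) ≤ A.expectedSize I

/-!
A single hard instance with 98 vertices, randomly renamed, already bounds the competitive ratio by
`30.95 / 49 < 0.6317`.

The instance has a block `U` of 20 vertices and a block `W` of 40 vertices, and it runs in three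
rounds. In the first round nine fresh vertices arrive one after the other and have to be matched at
once; counting from `0`, the `p`-th of them is adjacent to all but the first `p` vertices of `U`,
and the `p`-th vertex of `U` expires afterwards, as in the instance of Karp, Vazirani and Vazirani.
In the second round `W` arrives, completely joined to the eleven remaining vertices of `U`, and
these reach their deadlines: now they take the part of the vertices that have to be matched. Eleven
vertices of `W` expire, and in the third round 29 fresh vertices are to be matched to the remaining
vertices of `W` as in the first round. The graph has a perfect matching, of size 49. The adversary
gains in the second round: the vertices of `U` that were matched in the first round are not matched
again, but the others are matched to vertices of `W`, most of which will be needed in the third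
round.

The names within `U` and within `W` are permuted at random (`IsRenaming`). When a vertex in the role
`x` reaches its deadline, its candidates are indistinguishable, because exchanging the names of two
of them does not alter what has been disclosed (`mem_renamedOutput_mul_swap`). Hence, on average
over all renamings, a deterministic algorithm matches `x` equally often to each candidate
(`matchCount_eq_of_mem_candidates`). Together with the fact that every vertex is matched at most
once, this turns the expected size of the matching into the value of a linear program with one
variable for each of the 49 vertices that have candidates; an explicit dual solution bounds it by
`30.95` (`sum_le_of_constraints`). Averaging over the random bits carries the bound over to
randomized algorithms (`exists_expectedSize_le`).
-/

/-! ### Runs of a deterministic algorithm -/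

/-- The state reached by the algorithm `d` on the graph `G` after the time steps `l`. -/
noncomputable def runOn (G : SimpleGraph ℕ) (d : DetAlgorithm) (l : List Step) : RunState :=
  l.foldl (RunState.next G d) RunState.init

theorem runOn_append_singleton (G : SimpleGraph ℕ) (d : DetAlgorithm) (l : List Step) (x : Step) :
    runOn G d (l ++ [x]) = (runOn G d l).next G d x := by
  simp [runOn, List.foldl_append]

/-- A time step leaves the matching unchanged or, at the deadline of `v`, adds a permitted edge
at `v`. -/
theorem matching_next (G : SimpleGraph ℕ) (d : DetAlgorithm) (s : RunState) (x : Step) :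
    (s.next G d x).matching = s.matching ∨ ∃ v u, x = Step.deadline v ∧ s.CanMatch G v u ∧
      (s.next G d x).matching = insert s(v, u) s.matching := by
  cases x with
  | arrival v => exact Or.inl rfl
  | deadline v =>
    simp only [RunState.next]
    split
    · exact Or.inl rfl
    · rename_i u _
      split_ifs with h
      · exact Or.inr ⟨v, u, rfl, h, rfl⟩
      · exact Or.inl rfl

theorem matching_subset_next (G : SimpleGraph ℕ) (d : DetAlgorithm) (s : RunState) (x : Step) :
    s.matching ⊆ (s.next G d x).matching := by
  rcases matching_next G d s x with h | ⟨v, u, -, -, h⟩ <;> rw [h]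
  exact Finset.subset_insert _ _

theorem matching_subset_foldl (G : SimpleGraph ℕ) (d : DetAlgorithm) (l : List Step)
    (s : RunState) : s.matching ⊆ (l.foldl (RunState.next G d) s).matching := by
  induction l generalizing s with
  | nil => exact Finset.Subset.refl _
  | cons x l ih => exact (matching_subset_next G d s x).trans (ih _)

theorem expired_subset_next (G : SimpleGraph ℕ) (d : DetAlgorithm) (s : RunState) (x : Step) :
    s.expired ⊆ (s.next G d x).expired := by
  cases x with
  | arrival v => exact Finset.Subset.refl _
  | deadline v => exact Finset.subset_insert _ _

theorem mem_expired_runOn (G : SimpleGraph ℕ) (d : DetAlgorithm) (l : List Step) (v : ℕ)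
    (h : Step.deadline v ∈ l) : v ∈ (runOn G d l).expired := by
  induction l using List.reverseRecOn with
  | nil => simp at h
  | append_singleton l x ih =>
    rw [runOn_append_singleton]
    rcases List.mem_append.1 h with h | h
    · exact expired_subset_next G d _ x (ih h)
    · obtain rfl := List.mem_singleton.1 h
      exact Finset.mem_insert_self _ _

theorem mem_edgeSet_of_mem_matching (G : SimpleGraph ℕ) (d : DetAlgorithm) (l : List Step)
    {e : Sym2 ℕ} (he : e ∈ (runOn G d l).matching) : e ∈ G.edgeSet := by
  induction l using List.reverseRecOn with
  | nil => simp [runOn, RunState.init] at he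
  | append_singleton l x ih =>
    rw [runOn_append_singleton] at he
    rcases matching_next G d (runOn G d l) x with h | ⟨v, u, -, hc, h⟩ <;> rw [h] at he
    · exact ih he
    · rcases Finset.mem_insert.1 he with rfl | he
      · exact hc.1
      · exact ih he

theorem eq_of_mem_matching (G : SimpleGraph ℕ) (d : DetAlgorithm) (l : List Step)
    {e f : Sym2 ℕ} {w : ℕ} (he : e ∈ (runOn G d l).matching) (hf : f ∈ (runOn G d l).matching)
    (hwe : w ∈ e) (hwf : w ∈ f) : e = f := by
  induction l using List.reverseRecOn with
  | nil => simp [runOn, RunState.init] at he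
  | append_singleton l x ih =>
    rw [runOn_append_singleton] at he hf
    rcases matching_next G d (runOn G d l) x with h | ⟨v, u, -, hc, h⟩ <;> rw [h] at he hf
    · exact ih he hf
    · have key : ∀ e' ∈ (runOn G d l).matching, w ∈ e' → w ∉ s(v, u) := by
        intro e' he' hw hw'
        rcases Sym2.mem_iff.1 hw' with rfl | rfl
        · exact hc.2.2.2.1 ⟨e', he', hw⟩
        · exact hc.2.2.2.2 ⟨e', he', hw⟩
      rcases Finset.mem_insert.1 he with rfl | he <;> rcases Finset.mem_insert.1 hf with rfl | hf
      · rfl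
      · exact absurd hwe (key f hf hwf)
      · exact absurd hwf (key e he hwe)
      · exact ih he hf

theorem card_matching_le (G : SimpleGraph ℕ) (d : DetAlgorithm) (l : List Step) :
    (runOn G d l).matching.card ≤ l.length := by
  induction l using List.reverseRecOn with
  | nil => simp [runOn, RunState.init]
  | append_singleton l x ih =>
    rw [runOn_append_singleton, List.length_append, List.length_singleton]
    rcases matching_next G d (runOn G d l) x with h | ⟨v, u, -, -, h⟩ <;> rw [h]
    · omega
    · exact (Finset.card_insert_le _ _).trans (by omega)

/-- An expired vertex is not matched any more. -/
theorem mem_matching_of_expired (G : SimpleGraph ℕ) (d : DetAlgorithm) (l : List Step)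
    (s : RunState) {v : ℕ} (hv : v ∈ s.expired) (hl : Step.deadline v ∉ l) {e : Sym2 ℕ}
    (hve : v ∈ e) (he : e ∈ (l.foldl (RunState.next G d) s).matching) : e ∈ s.matching := by
  induction l generalizing s with
  | nil => exact he
  | cons x l ih =>
    rw [List.mem_cons, not_or] at hl
    have h1 := ih _ (expired_subset_next G d s x hv) hl.2 he
    rcases matching_next G d s x with h | ⟨w, u, rfl, hc, h⟩ <;> rw [h] at h1
    · exact h1
    · rcases Finset.mem_insert.1 h1 with rfl | h1
      · rcases Sym2.mem_iff.1 hve with rfl | rfl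
        · exact absurd rfl hl.1
        · exact absurd hv hc.2.2.1
      · exact h1

/-- A run only depends on the adjacencies between the vertices that occur in its time steps. -/
theorem runOn_congr (G G' : SimpleGraph ℕ) (d : DetAlgorithm) (Z : Set ℕ) (l : List Step)
    (hA : ∀ v, Step.arrival v ∈ l → v ∈ Z) (hD : ∀ v, Step.deadline v ∈ l → v ∈ Z)
    (hG : ∀ x ∈ Z, ∀ y ∈ Z, (G.Adj x y ↔ G'.Adj x y)) :
    runOn G d l = runOn G' d l ∧ ∀ v ∈ (runOn G d l).arrived, v ∈ Z := by
  classical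
  induction l using List.reverseRecOn with
  | nil => simp [runOn, RunState.init]
  | append_singleton l x ih =>
    obtain ⟨h1, h2⟩ := ih (fun v hv => hA v (by simp [hv])) (fun v hv => hD v (by simp [hv]))
    rw [runOn_append_singleton, runOn_append_singleton, ← h1]
    cases x with
    | arrival v =>
      have hv : v ∈ Z := hA v (by simp)
      refine ⟨?_, ?_⟩
      · simp only [RunState.next, RunState.mk.injEq, and_true]
        congr 3
        exact Finset.filter_congr fun y hy => hG v hv y (h2 y hy)
      · intro w hw
        rcases Finset.mem_insert.1 hw with rfl | hw
        · exact hv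
        · exact h2 w hw
    | deadline v =>
      have hv : v ∈ Z := hD v (by simp)
      refine ⟨?_, h2⟩
      have hc : ∀ u, (runOn G d l).CanMatch G v u ↔ (runOn G d l).CanMatch G' v u := by
        intro u
        constructor
        · rintro ⟨ha, hu, hr⟩
          exact ⟨(hG v hv u (h2 u hu)).1 ha, hu, hr⟩
        · rintro ⟨ha, hu, hr⟩
          exact ⟨(hG v hv u (h2 u hu)).2 ha, hu, hr⟩
      simp only [RunState.next, hc]

/-! ### Randomized algorithms -/

/-- The observations, arrivals and expirations of a run do not depend on the random bits; the
matching depends measurably on them. -/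
theorem exists_measurable_runOn {Ω : Type*} [MeasurableSpace Ω] (A : RandomizedAlgorithm Ω)
    (G : SimpleGraph ℕ) (l : List Step) :
    ∃ (h : List Observation) (a x : Finset ℕ) (M : Ω → Finset (Sym2 ℕ)),
      (∀ s, MeasurableSet (M ⁻¹' s)) ∧ ∀ ω, runOn G (A.alg ω) l = ⟨h, a, x, M ω⟩ := by
  classical
  induction l using List.reverseRecOn with
  | nil => exact ⟨[], ∅, ∅, fun _ => ∅, fun s => measurable_const (MeasurableSpace.measurableSet_top
      (s := s)), fun ω => rfl⟩
  | append_singleton l y ih =>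
    obtain ⟨h, a, x, M, hM, hrun⟩ := ih
    cases y with
    | arrival v =>
      refine ⟨h ++ [Observation.arrival v (a.filter (G.Adj v))], insert v a, x, M, hM, ?_⟩
      intro ω
      rw [runOn_append_singleton, hrun]
      simp only [RunState.next]
    | deadline v =>
      let h' := h ++ [Observation.deadline v]
      let F : Finset (Sym2 ℕ) → Option ℕ → Finset (Sym2 ℕ) := fun m o =>
        ((RunState.mk h a x m).next G (fun _ => o) (Step.deadline v)).matching
      refine ⟨h', a, insert v x, fun ω => F (M ω) (A.alg ω h'), ?_, ?_⟩
      · intro s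
        have hs : (fun ω => F (M ω) (A.alg ω h')) ⁻¹' s =
            ⋃ (i : Finset (Sym2 ℕ) × Option ℕ) (_ : F i.1 i.2 ∈ s),
              M ⁻¹' {i.1} ∩ {ω | A.alg ω h' = i.2} := by
          ext ω
          simp only [Set.mem_preimage, Set.mem_iUnion, Set.mem_inter_iff, Set.mem_singleton_iff,
            Set.mem_ofPred_eq, exists_prop]
          constructor
          · intro hω
            exact ⟨(M ω, A.alg ω h'), hω, rfl, rfl⟩
          · rintro ⟨i, hi, h1, h2⟩
            rwa [h1, h2]
        have : Countable (Sym2 ℕ) := Quotient.countable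
        rw [hs]
        exact MeasurableSet.iUnion fun i => MeasurableSet.iUnion fun _ =>
          (hM _).inter (A.measurableSet_alg _ _)
      · intro ω
        rw [runOn_append_singleton, hrun]
        rfl

theorem integrable_card_output {Ω : Type*} [MeasurableSpace Ω] (A : RandomizedAlgorithm Ω)
    (I : OnlineInstance) : Integrable (fun ω => (((A.alg ω).output I).card : ℝ)) A.μ := by
  have := A.isProbabilityMeasure
  refine Integrable.of_bound (C := I.timeline.length) ?_ (Filter.Eventually.of_forall fun ω => ?_)
  · obtain ⟨h, a, x, M, hM, hrun⟩ := exists_measurable_runOn A I.graph I.timeline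
    have heq : (fun ω => (((A.alg ω).output I).card : ℝ)) = fun ω => ((M ω).card : ℝ) := by
      funext ω
      exact congrArg (fun s : RunState => (s.matching.card : ℝ)) (hrun ω)
    rw [heq]
    refine Measurable.aestronglyMeasurable fun s _ => ?_
    exact hM ((fun m : Finset (Sym2 ℕ) => (m.card : ℝ)) ⁻¹' s)
  · rw [Real.norm_of_nonneg (Nat.cast_nonneg _)]
    exact_mod_cast card_matching_le I.graph (A.alg ω) I.timeline

/-- Yao's principle: if every deterministic algorithm achieves a total of at most `B * #S` on the
instances `I i`, `i ∈ S`, then no randomized algorithm achieves more than `B` on all of them. -/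
theorem exists_expectedSize_le {Ω ι : Type*} [MeasurableSpace Ω] (A : RandomizedAlgorithm Ω)
    (S : Finset ι) (hS : S.Nonempty) (I : ι → OnlineInstance) (B : ℝ)
    (hB : ∀ d : DetAlgorithm, ∑ i ∈ S, ((d.output (I i)).card : ℝ) ≤ S.card * B) :
    ∃ i ∈ S, A.expectedSize (I i) ≤ B := by
  have := A.isProbabilityMeasure
  refine Finset.exists_le_of_sum_le hS ?_
  simp only [RandomizedAlgorithm.expectedSize]
  rw [← integral_finsetSum S fun i _ => integrable_card_output A (I i)]
  calc _ ≤ ∫ _, (S.card * B : ℝ) ∂A.μ :=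
        integral_mono (integrable_finsetSum S fun i _ => integrable_card_output A (I i))
          (integrable_const _) fun ω => hB (A.alg ω)
    _ = _ := by simp

/-! ### Maximum matchings -/

theorem OnlineInstance.ncard_edgeSet_le_opt (I : OnlineInstance) (M : I.graph.Subgraph)
    (hM : M.IsMatching) : M.edgeSet.ncard ≤ I.opt := by
  have hfin : I.graph.edgeSet.Finite := by
    refine (I.verts.sym2.finite_toSet).subset fun e he => ?_
    induction e with
    | _ u v =>
      exact Finset.mem_coe.2 (Finset.mk_mem_sym2_iff.2 (I.mem_verts_of_adj u v he))
  refine le_csSup ⟨I.graph.edgeSet.ncard, ?_⟩ ⟨M, hM, rfl⟩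
  rintro m ⟨M', -, rfl⟩
  exact Set.ncard_le_ncard M'.edgeSet_subset hfin

/-! ### The hard instance -/

/-- The roles to which the vertex in the role `x` may be matched at its deadline; there are such roles
only if `9 ≤ x < 20`, `60 ≤ x < 69` or `91 ≤ x < 120`. -/
def candidates (x : ℕ) : Finset ℕ :=
  if x < 9 then ∅ else if x < 20 then Finset.Ico 20 60 else if x < 60 then ∅
  else if x < 69 then Finset.Ico (x - 60) 20 else if x < 91 then ∅ else Finset.Ico (x - 60) 60

theorem mem_candidates {x y : ℕ} : y ∈ candidates x ↔
    (9 ≤ x ∧ x < 20 ∧ 20 ≤ y ∧ y < 60) ∨ (60 ≤ x ∧ x < 69 ∧ x - 60 ≤ y ∧ y < 20) ∨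
      (91 ≤ x ∧ x - 60 ≤ y ∧ y < 60) := by
  unfold candidates
  split_ifs <;> simp <;> omega

/-- The hard graph on the roles: `U` consists of `0, …, 19`, `W` of `20, …, 59`, and the fresh
vertices are `60, …, 68` in the first round and `91, …, 119` in the third. A fresh vertex `60 + p`
is adjacent to the roles from `p` on in its block. -/
def roleGraph : SimpleGraph ℕ := SimpleGraph.fromRel fun x y => y ∈ candidates x

theorem roleGraph_adj {x y : ℕ} :
    roleGraph.Adj x y ↔ y ∈ candidates x ∨ x ∈ candidates y := by
  rw [roleGraph, SimpleGraph.fromRel_adj]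
  refine ⟨And.right, fun h => ⟨?_, h⟩⟩
  rintro rfl
  simp only [mem_candidates] at h
  omega

/-- The time steps of the instance in which every vertex is named by its role. -/
def roleTimeline : List Step :=
  (List.range' 0 20).map Step.arrival ++
  (List.range' 0 9).flatMap
    (fun p => [Step.arrival (60 + p), Step.deadline (60 + p), Step.deadline p]) ++
  (List.range' 20 40).map Step.arrival ++
  (List.range' 9 22).map Step.deadline ++
  (List.range' 31 29).flatMap
    (fun p => [Step.arrival (60 + p), Step.deadline (60 + p), Step.deadline p])

/-- Times that increase along `roleTimeline`. Only their order matters. -/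
def Step.time : Step → ℕ
  | Step.arrival v =>
      if v < 20 then v else if v < 60 then 200 + v else if v < 69 then 100 + 3 * (v - 60)
      else 500 + 3 * (v - 60)
  | Step.deadline v =>
      if v < 9 then 102 + 3 * v else if v < 31 then 300 + v else if v < 60 then 502 + 3 * v
      else if v < 69 then 101 + 3 * (v - 60) else 501 + 3 * (v - 60)

theorem pairwise_roleTimeline : roleTimeline.Pairwise fun x y => x.time < y.time := by
  decide +kernel

/-- The roles that occur in the instance. -/
def roles : Finset ℕ := Finset.range 69 ∪ Finset.Ico 91 120

theorem mem_roles {v : ℕ} : v ∈ roles ↔ v < 69 ∨ (91 ≤ v ∧ v < 120) := by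
  simp [roles]

theorem arrival_mem_roleTimeline {v : ℕ} : Step.arrival v ∈ roleTimeline ↔ v ∈ roles := by
  simp only [roleTimeline, mem_roles, List.mem_append, List.mem_map, List.mem_flatMap,
    List.mem_range'_1, List.mem_cons, Step.arrival.injEq, reduceCtorEq, exists_eq_right,
    List.not_mem_nil, or_false, and_false, exists_false]
  constructor
  · rintro (((h | ⟨p, h⟩) | h) | ⟨p, h⟩) <;> omega
  · rintro h
    by_cases h1 : v < 20
    · omega
    by_cases h2 : v < 60
    · omega
    by_cases h3 : v < 69
    · exact Or.inl (Or.inl (Or.inr ⟨v - 60, by omega⟩))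
    · exact Or.inr ⟨v - 60, by omega⟩

theorem deadline_mem_roleTimeline {v : ℕ} : Step.deadline v ∈ roleTimeline ↔ v ∈ roles := by
  simp only [roleTimeline, mem_roles, List.mem_append, List.mem_map, List.mem_flatMap,
    List.mem_range'_1, List.mem_cons, Step.deadline.injEq, reduceCtorEq, exists_eq_right,
    List.not_mem_nil, or_false, false_or, and_false, exists_false]
  constructor
  · rintro ((⟨p, h⟩ | h) | ⟨p, h⟩) <;> omega
  · rintro h
    by_cases h1 : v < 9
    · exact Or.inl (Or.inl ⟨v, by omega⟩)
    by_cases h2 : v < 31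
    · omega
    by_cases h3 : v < 60
    · exact Or.inr ⟨v, by omega⟩
    by_cases h4 : v < 69
    · exact Or.inl (Or.inl ⟨v - 60, by omega⟩)
    · exact Or.inr ⟨v - 60, by omega⟩

/-- In a list sorted by `f`, smaller elements come first. -/
theorem List.Pairwise.pair_sublist {α : Type*} {f : α → ℕ} {l : List α}
    (hl : l.Pairwise fun x y => f x < f y) {a b : α} (ha : a ∈ l) (hb : b ∈ l) (hab : f a < f b) :
    [a, b].Sublist l := by
  induction l with
  | nil => simp at ha
  | cons x l ih =>
    rw [List.pairwise_cons] at hl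
    rcases List.mem_cons.1 ha with rfl | ha' <;> rcases List.mem_cons.1 hb with rfl | hb'
    · omega
    · exact List.Sublist.cons_cons _ (List.singleton_sublist.2 hb')
    · have := hl.1 a ha'
      omega
    · exact (ih hl.2 ha' hb').cons _

/-- A list sorted by `f` splits at every threshold. -/
theorem List.Pairwise.filter_append_filter {α : Type*} {f : α → ℕ} {l : List α}
    (hl : l.Pairwise fun x y => f x < f y) (k : ℕ) :
    l.filter (fun x => f x < k) ++ l.filter (fun x => k ≤ f x) = l := by
  induction l with
  | nil => rfl
  | cons x l ih =>
    rw [List.pairwise_cons] at hl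
    by_cases hx : f x < k
    · simp [hx, ih hl.2]
    · have h1 : l.filter (fun y => f y < k) = [] := by
        rw [List.filter_eq_nil_iff]
        intro y hy
        have := hl.1 y hy
        simp
        omega
      have h2 : l.filter (fun y => k ≤ f y) = l := by
        rw [List.filter_eq_self]
        intro y hy
        have := hl.1 y hy
        simp
        omega
      simp [hx, h1, h2, not_lt.1 hx]

/-! ### Renaming the vertices -/

/-- A permutation of the names within each of the two blocks `0, …, 19` and `20, …, 59`: the vertex
in the role `x` gets the name `σ x`. -/
def IsRenaming (σ : Equiv.Perm ℕ) : Prop :=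
  ∀ x, (σ x < 20 ↔ x < 20) ∧ (σ x < 60 ↔ x < 60) ∧ (60 ≤ x → σ x = x)

theorem IsRenaming.symm {σ : Equiv.Perm ℕ} (hσ : IsRenaming σ) (x : ℕ) :
    (σ.symm x < 20 ↔ x < 20) ∧ (σ.symm x < 60 ↔ x < 60) ∧ (60 ≤ x → σ.symm x = x) := by
  have h := hσ (σ.symm x)
  rw [Equiv.apply_symm_apply] at h
  refine ⟨h.1.symm, h.2.1.symm, fun hx => ?_⟩
  exact (h.2.2 (by omega)).symm

theorem IsRenaming.mem_roles_symm {σ : Equiv.Perm ℕ} (hσ : IsRenaming σ) {x : ℕ} :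
    σ.symm x ∈ roles ↔ x ∈ roles := by
  have := hσ.symm x
  rw [mem_roles, mem_roles]
  omega

/-- Renaming changes the names that appear at the deadlines. The vertices of a block arrive in the
order of their names, so that the arrivals disclose nothing about their roles. -/
def Step.rename (σ : Equiv.Perm ℕ) : Step → Step
  | Step.arrival v => Step.arrival v
  | Step.deadline v => Step.deadline (σ v)

theorem Step.rename_injective (σ : Equiv.Perm ℕ) : Function.Injective (Step.rename σ) := by
  intro x y h
  cases x <;> cases y <;> simp_all [Step.rename]

theorem arrival_mem_map_rename {σ : Equiv.Perm ℕ} {l : List Step} {v : ℕ} :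
    Step.arrival v ∈ l.map (Step.rename σ) ↔ Step.arrival v ∈ l := by
  rw [List.mem_map]
  constructor
  · rintro ⟨x, hx, h⟩
    cases x <;> simp_all [Step.rename]
  · exact fun h => ⟨_, h, rfl⟩

theorem deadline_mem_map_rename {σ : Equiv.Perm ℕ} {l : List Step} {v : ℕ} :
    Step.deadline v ∈ l.map (Step.rename σ) ↔ Step.deadline (σ.symm v) ∈ l := by
  rw [List.mem_map]
  constructor
  · rintro ⟨x, hx, h⟩
    cases x with
    | arrival w => simp [Step.rename] at h
    | deadline w =>
      simp only [Step.rename, Step.deadline.injEq] at h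
      rwa [← h, Equiv.symm_apply_apply]
  · exact fun h => ⟨_, h, by simp [Step.rename]⟩

/-- The hard graph, with the vertex in the role `x` named `σ x`. -/
def renamedGraph (σ : Equiv.Perm ℕ) : SimpleGraph ℕ := roleGraph.comap σ.symm

theorem renamedGraph_adj {σ : Equiv.Perm ℕ} {x y : ℕ} : (renamedGraph σ).Adj x y ↔
    σ.symm y ∈ candidates (σ.symm x) ∨ σ.symm x ∈ candidates (σ.symm y) := by
  rw [renamedGraph, SimpleGraph.comap_adj, roleGraph_adj]

theorem mem_roles_of_adj {σ : Equiv.Perm ℕ} (hσ : IsRenaming σ) {x y : ℕ}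
    (h : (renamedGraph σ).Adj x y) : x ∈ roles ∧ y ∈ roles := by
  rw [← hσ.mem_roles_symm, ← hσ.mem_roles_symm (x := y)]
  simp only [renamedGraph_adj, mem_candidates] at h
  simp only [mem_roles]
  omega

theorem time_arrival_lt_time_deadline {σ : Equiv.Perm ℕ} (hσ : IsRenaming σ) (x : ℕ) :
    (Step.arrival (σ x)).time < (Step.deadline x).time := by
  have := hσ x
  simp only [Step.time]
  split_ifs <;> omega

theorem time_arrival_lt_time_deadline_of_adj {σ : Equiv.Perm ℕ} (hσ : IsRenaming σ) {x y : ℕ}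
    (h : (renamedGraph σ).Adj x y) :
    (Step.arrival x).time < (Step.deadline (σ.symm y)).time := by
  have hx := hσ.symm x
  have hy := hσ.symm y
  simp only [renamedGraph_adj, mem_candidates] at h
  simp only [Step.time]
  generalize σ.symm x = x' at *
  generalize σ.symm y = y' at *
  split_ifs <;> omega

theorem sublist_map_rename {σ : Equiv.Perm ℕ} (hσ : IsRenaming σ) {x y : ℕ} (hx : x ∈ roles)
    (hy : y ∈ roles) (h : (Step.arrival x).time < (Step.deadline (σ.symm y)).time) :
    [Step.arrival x, Step.deadline y].Sublist (roleTimeline.map (Step.rename σ)) := by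
  have := (pairwise_roleTimeline.pair_sublist (arrival_mem_roleTimeline.2 hx)
    (deadline_mem_roleTimeline.2 (hσ.mem_roles_symm.2 hy)) h).map (Step.rename σ)
  simpa [Step.rename] using this

/-- The hard instance, with the vertex in the role `x` named `σ x`. -/
def hardInstance (σ : Equiv.Perm ℕ) (hσ : IsRenaming σ) : OnlineInstance where
  verts := roles
  graph := renamedGraph σ
  mem_verts_of_adj _ _ h := mem_roles_of_adj hσ h
  timeline := roleTimeline.map (Step.rename σ)
  nodup := List.Nodup.map (Step.rename_injective σ)
    (pairwise_roleTimeline.imp fun h he => by simp [he] at h)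
  arrival_mem_iff _ := arrival_mem_map_rename.trans arrival_mem_roleTimeline
  deadline_mem_iff _ :=
    deadline_mem_map_rename.trans (deadline_mem_roleTimeline.trans hσ.mem_roles_symm)
  arrival_before_deadline v hv := sublist_map_rename hσ hv hv (by
    simpa using time_arrival_lt_time_deadline hσ (σ.symm v))
  neighbor_before_deadline _ _ h := sublist_map_rename hσ (mem_roles_of_adj hσ h).1
    (mem_roles_of_adj hσ h).2 (time_arrival_lt_time_deadline_of_adj hσ h)

theorem isBipartite_renamedGraph {σ : Equiv.Perm ℕ} : (renamedGraph σ).IsBipartite := by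
  refine ⟨SimpleGraph.Coloring.mk
    (fun x => if σ.symm x < 20 ∨ 91 ≤ σ.symm x then (0 : Fin 2) else 1) ?_⟩
  intro x y h
  simp only [renamedGraph_adj, mem_candidates] at h
  split_ifs <;> simp <;> omega

/-- The partner of the role `x` in a perfect matching. -/
def partner (x : ℕ) : ℕ :=
  if x < 9 then x + 60 else if x < 20 then x + 11 else if x < 31 then x - 11
  else if x < 60 then x + 60 else x - 60

/-- The graph of the hard instance has a perfect matching of its 98 vertices. -/
theorem le_opt_hardInstance {σ : Equiv.Perm ℕ} (hσ : IsRenaming σ) :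
    49 ≤ (hardInstance σ hσ).opt := by
  let M : (hardInstance σ hσ).graph.Subgraph :=
    { verts := {x | σ.symm x ∈ roles}
      Adj := fun x y => σ.symm x ∈ roles ∧ σ.symm y = partner (σ.symm x)
      adj_sub := by
        rintro x y ⟨hx, hy⟩
        refine renamedGraph_adj.2 ?_
        rw [hy]
        rw [mem_roles] at hx
        simp only [mem_candidates, partner]
        split_ifs <;> omega
      edge_vert := fun h => h.1
      symm := ⟨by
        rintro x y ⟨hx, hy⟩
        rw [hy]
        simp only [mem_roles, partner] at hx ⊢
        split_ifs <;> omega⟩ }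
  have hM : M.IsMatching := by
    intro x hx
    refine ⟨σ (partner (σ.symm x)), ⟨hx, by simp⟩, ?_⟩
    rintro y ⟨-, hy⟩
    rw [← hy, Equiv.apply_symm_apply]
  refine le_trans ?_ ((hardInstance σ hσ).ncard_edgeSet_le_opt M hM)
  let f : ℕ → Sym2 ℕ := fun x => s(σ x, σ (partner x))
  have hf : Set.InjOn f (Finset.range 9 ∪ Finset.Ico 20 60 : Finset ℕ) := by
    intro x hx y hy h
    simp only [Finset.coe_union, Finset.coe_range, Finset.coe_Ico, Set.mem_union, Set.mem_Iio,
      Set.mem_Ico] at hx hy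
    simp only [f, Sym2.eq_iff, EmbeddingLike.apply_eq_iff_eq, partner] at h
    split_ifs at h <;> omega
  have hsub : f '' (Finset.range 9 ∪ Finset.Ico 20 60 : Finset ℕ) ⊆ M.edgeSet := by
    rintro _ ⟨x, hx, rfl⟩
    simp only [Finset.coe_union, Finset.coe_range, Finset.coe_Ico, Set.mem_union, Set.mem_Iio,
      Set.mem_Ico] at hx
    refine ⟨?_, by simp⟩
    rw [Equiv.symm_apply_apply, mem_roles]
    omega
  have hfin : M.edgeSet.Finite := by
    refine (roles.sym2.finite_toSet).subset fun e he => ?_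
    induction e with
    | _ u v =>
      exact Finset.mem_coe.2 (Finset.mk_mem_sym2_iff.2 (mem_roles_of_adj hσ (M.adj_sub he)))
  calc 49 = (f '' (Finset.range 9 ∪ Finset.Ico 20 60 : Finset ℕ)).ncard := by
        rw [hf.ncard_image, Set.ncard_coe_finset]
        rfl
    _ ≤ _ := Set.ncard_le_ncard hsub hfin

/-! ### Indistinguishable candidates -/

/-- The matching that `d` produces on the renamed hard instance. -/
noncomputable def renamedOutput (d : DetAlgorithm) (σ : Equiv.Perm ℕ) : Finset (Sym2 ℕ) :=
  (runOn (renamedGraph σ) d (roleTimeline.map (Step.rename σ))).matching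

theorem IsRenaming.mul_swap {σ : Equiv.Perm ℕ} (hσ : IsRenaming σ) {x a b : ℕ}
    (ha : a ∈ candidates x) (hb : b ∈ candidates x) : IsRenaming (σ * Equiv.swap a b) := by
  rw [mem_candidates] at ha hb
  intro y
  have hy := hσ y
  have h1 := hσ a
  have h2 := hσ b
  rw [Equiv.Perm.mul_apply, Equiv.swap_apply_def]
  split_ifs <;> omega

theorem symm_mul_swap_apply (σ : Equiv.Perm ℕ) (a b y : ℕ) :
    (σ * Equiv.swap a b).symm y = Equiv.swap a b (σ.symm y) := by
  rw [Equiv.symm_apply_eq]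
  simp

/-- The edges disclosed up to the deadline of `x` do not change when the names of two candidates of
`x` are exchanged: no edge to only one of the two candidates has been disclosed. -/
theorem renamedGraph_mul_swap_adj {σ : Equiv.Perm ℕ} (hσ : IsRenaming σ) {x a b : ℕ}
    (ha : a ∈ candidates x) (hb : b ∈ candidates x) {u v : ℕ}
    (hu : (Step.arrival u).time ≤ (Step.deadline x).time)
    (hv : (Step.arrival v).time ≤ (Step.deadline x).time) (h : (renamedGraph σ).Adj u v) :
    (renamedGraph (σ * Equiv.swap a b)).Adj u v := by
  have key : ∀ u v : ℕ, (Step.arrival u).time ≤ (Step.deadline x).time →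
      (Step.arrival v).time ≤ (Step.deadline x).time → σ.symm v ∈ candidates (σ.symm u) →
      Equiv.swap a b (σ.symm v) ∈ candidates (Equiv.swap a b (σ.symm u)) := by
    intro u v hu hv h
    have h1 := hσ.symm u
    have h2 := hσ.symm v
    -- `u` and `v` have arrived: no fresh vertex after `x`, and no vertex of `W` in the first round
    have hux : (60 ≤ u → u < 69 → x < 69 → 60 ≤ x → u ≤ x) ∧ (91 ≤ u → u ≤ x ∧ 91 ≤ x) := by
      rw [mem_candidates] at ha
      simp only [Step.time] at hu
      split_ifs at hu <;> omega
    have hvx : 20 ≤ v → v < 60 → 60 ≤ x → 69 ≤ x := by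
      rw [mem_candidates] at ha
      simp only [Step.time] at hv
      split_ifs at hv <;> omega
    clear hu hv
    rw [mem_candidates] at ha hb h ⊢
    generalize σ.symm u = u' at *
    generalize σ.symm v = v' at *
    -- once a candidate of `u'` has arrived, `u'` itself is not a candidate of `x`
    have hne : u' ≠ a ∧ u' ≠ b := by
      rcases h with h | h | h <;> omega
    rw [Equiv.swap_apply_of_ne_of_ne hne.1 hne.2, Equiv.swap_apply_def]
    clear hne
    rcases h with h | h | h <;> split_ifs <;> omega
  rw [renamedGraph_adj, symm_mul_swap_apply, symm_mul_swap_apply]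
  rw [renamedGraph_adj] at h
  exact h.imp (key u v hu hv) (key v u hv hu)

/-- The edge that the algorithm chooses at the deadline of `x` is determined by the steps up to this
deadline. -/
theorem mem_renamedOutput_iff (d : DetAlgorithm) (σ : Equiv.Perm ℕ) {x : ℕ} (hx : x ∈ roles)
    {e : Sym2 ℕ} (he : σ x ∈ e) : e ∈ renamedOutput d σ ↔
      e ∈ (runOn (renamedGraph σ) d ((roleTimeline.filter
        fun s => s.time < (Step.deadline x).time + 1).map (Step.rename σ))).matching := by
  set k := (Step.deadline x).time + 1 with hk
  have hsplit := pairwise_roleTimeline.filter_append_filter k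
  rw [renamedOutput, ← hsplit, List.map_append]
  rw [runOn, List.foldl_append, hsplit, ← runOn]
  constructor
  · refine mem_matching_of_expired _ _ _ _ (v := σ x) ?_ ?_ he
    · apply mem_expired_runOn
      rw [deadline_mem_map_rename, Equiv.symm_apply_apply, List.mem_filter]
      exact ⟨deadline_mem_roleTimeline.2 hx, by simp [hk]⟩
    · rw [deadline_mem_map_rename, Equiv.symm_apply_apply, List.mem_filter]
      simp [hk]
  · exact fun h => matching_subset_foldl _ _ _ _ h

/-- Up to the deadline of `x`, exchanging the names of two candidates of `x` does not change the
run. -/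
theorem runOn_mul_swap (d : DetAlgorithm) {σ : Equiv.Perm ℕ} (hσ : IsRenaming σ) {x a b : ℕ}
    (ha : a ∈ candidates x) (hb : b ∈ candidates x) :
    runOn (renamedGraph σ) d ((roleTimeline.filter
        fun s => s.time < (Step.deadline x).time + 1).map (Step.rename σ)) =
      runOn (renamedGraph (σ * Equiv.swap a b)) d ((roleTimeline.filter
        fun s => s.time < (Step.deadline x).time + 1).map (Step.rename (σ * Equiv.swap a b))) := by
  have hmap : (roleTimeline.filter fun s => s.time < (Step.deadline x).time + 1).map
      (Step.rename (σ * Equiv.swap a b)) =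
      (roleTimeline.filter fun s => s.time < (Step.deadline x).time + 1).map (Step.rename σ) := by
    refine List.map_congr_left fun s hs => ?_
    rw [List.mem_filter, decide_eq_true_eq] at hs
    cases s with
    | arrival v => rfl
    | deadline v =>
      -- the candidates of `x` have their deadlines after that of `x`
      have hne : ∀ y ∈ candidates x, v ≠ y := by
        rintro y hy rfl
        have h := hs.2
        rw [mem_candidates] at hy
        simp only [Step.time] at h
        split_ifs at h <;> omega
      simp only [Step.rename, Equiv.Perm.mul_apply, Equiv.swap_apply_of_ne_of_ne (hne a ha)
        (hne b hb)]
  rw [hmap]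
  refine (runOn_congr _ _ d {v | (Step.arrival v).time ≤ (Step.deadline x).time} _ ?_ ?_ ?_).1
  · intro v hv
    rw [arrival_mem_map_rename, List.mem_filter, decide_eq_true_eq] at hv
    exact Nat.lt_succ_iff.1 hv.2
  · intro v hv
    rw [deadline_mem_map_rename, List.mem_filter, decide_eq_true_eq] at hv
    have := time_arrival_lt_time_deadline hσ (σ.symm v)
    rw [Equiv.apply_symm_apply] at this
    exact (this.trans_le (Nat.lt_succ_iff.1 hv.2)).le
  · intro u hu v hv
    refine ⟨renamedGraph_mul_swap_adj hσ ha hb hu hv, fun h => ?_⟩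
    have := renamedGraph_mul_swap_adj (hσ.mul_swap ha hb) ha hb hu hv h
    rwa [mul_assoc, Equiv.swap_mul_self, mul_one] at this

/-- Exchanging the names of two candidates of `x` exchanges the events that `x` is matched to the
one or to the other. -/
theorem mem_renamedOutput_mul_swap (d : DetAlgorithm) {σ : Equiv.Perm ℕ} (hσ : IsRenaming σ)
    {x a b : ℕ} (ha : a ∈ candidates x) (hb : b ∈ candidates x) :
    s(σ x, σ a) ∈ renamedOutput d σ ↔
      s((σ * Equiv.swap a b) x, (σ * Equiv.swap a b) b) ∈ renamedOutput d (σ * Equiv.swap a b) := by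
  have hx : x ∈ roles := by
    rw [mem_candidates] at ha
    rw [mem_roles]
    omega
  have hne : ∀ y ∈ candidates x, x ≠ y := by
    intro y hy
    rw [mem_candidates] at hy
    omega
  rw [mem_renamedOutput_iff d σ hx (Sym2.mem_mk_left _ _),
    mem_renamedOutput_iff d (σ * Equiv.swap a b) hx (Sym2.mem_mk_left _ _),
    runOn_mul_swap d hσ ha hb]
  simp only [Equiv.Perm.mul_apply, Equiv.swap_apply_right,
    Equiv.swap_apply_of_ne_of_ne (hne a ha) (hne b hb)]

/-! ### The average over all renamings -/

/-- All renamings of the hard instance. -/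
noncomputable def renamings : Finset (Equiv.Perm ℕ) := by
  classical
  exact (permsOfFinset (Finset.range 60)).filter IsRenaming

theorem mem_renamings {σ : Equiv.Perm ℕ} : σ ∈ renamings ↔ IsRenaming σ := by
  classical
  rw [renamings, Finset.mem_filter, mem_perms_of_finset_iff, and_iff_right_iff_imp]
  intro h x hx
  rw [Finset.mem_range]
  by_contra hlt
  exact hx ((h x).2.2 (not_lt.1 hlt))

theorem one_mem_renamings : 1 ∈ renamings := mem_renamings.2 fun x => by simp

open Classical in
/-- The number of renamings for which the vertices in the roles `x` and `y` are matched to each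
other. -/
noncomputable def matchCount (d : DetAlgorithm) (x y : ℕ) : ℕ :=
  (renamings.filter fun σ => s(σ x, σ y) ∈ renamedOutput d σ).card

theorem matchCount_comm (d : DetAlgorithm) (x y : ℕ) : matchCount d x y = matchCount d y x := by
  simp only [matchCount, Sym2.eq_swap]

theorem matchCount_eq_of_mem_candidates (d : DetAlgorithm) {x a b : ℕ} (ha : a ∈ candidates x)
    (hb : b ∈ candidates x) : matchCount d x a = matchCount d x b := by
  classical
  refine Finset.card_nbij' (· * Equiv.swap a b) (· * Equiv.swap a b) ?_ ?_ ?_ ?_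
  · intro σ hσ
    simp only [Finset.coe_filter, mem_renamings, Set.mem_ofPred_eq] at hσ ⊢
    exact ⟨hσ.1.mul_swap ha hb, (mem_renamedOutput_mul_swap d hσ.1 ha hb).1 hσ.2⟩
  · intro σ hσ
    simp only [Finset.coe_filter, mem_renamings, Set.mem_ofPred_eq] at hσ ⊢
    refine ⟨hσ.1.mul_swap ha hb, ?_⟩
    have := (mem_renamedOutput_mul_swap d hσ.1 hb ha).1 hσ.2
    rwa [Equiv.swap_comm b a] at this
  · intro σ _
    simp [mul_assoc]
  · intro σ _
    simp [mul_assoc]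

/-- Every vertex is matched at most once. -/
theorem sum_matchCount_le (d : DetAlgorithm) (x : ℕ) (A : Finset ℕ) :
    ∑ y ∈ A, matchCount d x y ≤ renamings.card := by
  classical
  simp only [matchCount, Finset.card_filter]
  rw [Finset.sum_comm, Finset.card_eq_sum_ones]
  refine Finset.sum_le_sum fun σ _ => ?_
  rw [← Finset.card_filter, Finset.card_le_one]
  intro y hy z hz
  have h := eq_of_mem_matching _ _ _ (Finset.mem_filter.1 hy).2 (Finset.mem_filter.1 hz).2
    (Sym2.mem_mk_left _ _) (Sym2.mem_mk_left _ _)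
  exact σ.injective (Sym2.congr_right.1 h)

/-- The roles that have candidates. -/
def servers : Finset ℕ := Finset.Ico 9 20 ∪ (Finset.Ico 60 69 ∪ Finset.Ico 91 120)

/-- Every edge of the graph joins a server to one of its candidates. -/
theorem sum_card_renamedOutput_le (d : DetAlgorithm) :
    ∑ σ ∈ renamings, (renamedOutput d σ).card ≤
      ∑ x ∈ servers, ∑ y ∈ candidates x, matchCount d x y := by
  classical
  simp only [matchCount, Finset.card_filter]
  rw [Finset.sum_congr rfl fun x _ => Finset.sum_comm, Finset.sum_comm]
  refine Finset.sum_le_sum fun σ _ => ?_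
  rw [Finset.sum_sigma', ← Finset.card_filter]
  refine (Finset.card_le_card (t := Finset.image (fun i : (_ : ℕ) × ℕ => s(σ i.1, σ i.2)) _)
    fun e he => ?_).trans Finset.card_image_le
  have hadj := mem_edgeSet_of_mem_matching _ _ _ he
  have key : ∀ u v, s(u, v) ∈ renamedOutput d σ → σ.symm v ∈ candidates (σ.symm u) →
      s(u, v) ∈ Finset.image (fun i : (_ : ℕ) × ℕ => s(σ i.1, σ i.2))
        ((servers.sigma candidates).filter fun i => s(σ i.1, σ i.2) ∈ renamedOutput d σ) := by
    intro u v he h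
    refine Finset.mem_image.2 ⟨⟨σ.symm u, σ.symm v⟩, Finset.mem_filter.2 ⟨?_, by simpa⟩, by simp⟩
    rw [Finset.mem_sigma]
    refine ⟨?_, h⟩
    rw [mem_candidates] at h
    simp only [servers, Finset.mem_union, Finset.mem_Ico]
    omega
  induction e with
  | _ u v =>
    rcases renamedGraph_adj.1 hadj with h | h
    · exact key u v he h
    · rw [Sym2.eq_swap] at he ⊢
      exact key v u he h

/-! ### The linear program -/

theorem candidates_of_lt_twenty {x : ℕ} (h : 9 ≤ x) (h' : x < 20) :
    candidates x = Finset.Ico 20 60 := by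
  ext y
  rw [mem_candidates, Finset.mem_Ico]
  omega

theorem candidates_of_lt_sixty_nine {x : ℕ} (h : 60 ≤ x) (h' : x < 69) :
    candidates x = Finset.Ico (x - 60) 20 := by
  ext y
  rw [mem_candidates, Finset.mem_Ico]
  omega

theorem candidates_of_ninety_one_le {x : ℕ} (h : 91 ≤ x) :
    candidates x = Finset.Ico (x - 60) 60 := by
  ext y
  rw [mem_candidates, Finset.mem_Ico]
  omega

theorem sum_matchCount_candidates (d : DetAlgorithm) {x a : ℕ} (ha : a ∈ candidates x) :
    ∑ y ∈ candidates x, matchCount d x y = (candidates x).card * matchCount d x a := by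
  rw [Finset.sum_congr rfl fun y hy => matchCount_eq_of_mem_candidates d hy ha, Finset.sum_const,
    smul_eq_mul]

/-- The candidate of `x` with the latest deadline. It represents all candidates of `x`, which are
equally often matched to `x`. -/
def lastCandidate (x : ℕ) : ℕ := if 60 ≤ x ∧ x < 69 then 19 else 59

theorem lastCandidate_mem {x : ℕ} (hx : x ∈ servers) : lastCandidate x ∈ candidates x := by
  simp only [servers, Finset.mem_union, Finset.mem_Ico] at hx
  rw [mem_candidates, lastCandidate]
  split_ifs <;> omega

/-- The constraint for the role `x` of the first block: it is matched at the deadline of one of the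
vertices `60, …, 68`, or at its own deadline. -/
theorem matchCount_constraint_first_block (d : DetAlgorithm) {x : ℕ} (h : 9 ≤ x) (h' : x < 20) :
    ∑ p ∈ Finset.Ico 60 69, matchCount d p (lastCandidate p) +
      40 * matchCount d x (lastCandidate x) ≤ renamings.card := by
  have h1 := sum_matchCount_le d x (Finset.Ico 60 69 ∪ candidates x)
  rw [candidates_of_lt_twenty h h', Finset.sum_union (by
    rw [Finset.disjoint_left]; intro y; simp only [Finset.mem_Ico]; omega)] at h1
  have h2 := sum_matchCount_candidates d (lastCandidate_mem (x := x) (by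
    simp only [servers, Finset.mem_union, Finset.mem_Ico]; omega))
  rw [candidates_of_lt_twenty h h', Nat.card_Ico] at h2
  rw [h2] at h1
  refine le_trans (Nat.add_le_add_right (Finset.sum_le_sum fun p hp => ?_) _) h1
  rw [Finset.mem_Ico] at hp
  rw [matchCount_comm d x p, matchCount_eq_of_mem_candidates d (lastCandidate_mem (x := p) (by
    simp only [servers, Finset.mem_union, Finset.mem_Ico]; omega)) (b := x)]
  rw [mem_candidates]
  omega

/-- The constraint for the last role of the second block, which is a candidate of all the vertices
that choose from this block. -/
theorem matchCount_constraint_second_block (d : DetAlgorithm) :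
    ∑ x ∈ Finset.Ico 9 20, matchCount d x (lastCandidate x) +
      ∑ x ∈ Finset.Ico 91 120, matchCount d x (lastCandidate x) ≤ renamings.card := by
  have h : ∀ x : ℕ, 69 ≤ x ∨ x < 60 → matchCount d x (lastCandidate x) = matchCount d 59 x := by
    intro x hx
    rw [matchCount_comm d 59 x, lastCandidate, if_neg (by omega)]
  rw [Finset.sum_congr rfl fun x hx => h x (by rw [Finset.mem_Ico] at hx; omega),
    Finset.sum_congr rfl fun x hx => h x (by rw [Finset.mem_Ico] at hx; omega),
    ← Finset.sum_union (by
      rw [Finset.disjoint_left]; intro y; simp only [Finset.mem_Ico]; omega)]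
  exact sum_matchCount_le d 59 _

theorem matchCount_constraint_server (d : DetAlgorithm) {x : ℕ} (hx : x ∈ servers) :
    (candidates x).card * matchCount d x (lastCandidate x) ≤ renamings.card := by
  rw [← sum_matchCount_candidates d (lastCandidate_mem hx)]
  exact sum_matchCount_le d x _

/-- Weak duality for the linear program. The dual solution gives the weight `12` to the constraint
of the second block, the weight `(40 - 12) / 40 = 7 / 10` to each of the eleven constraints of the
first block, and to each server the weight that makes its own dual constraint tight or, if this
weight is negative, the weight `0`. Its value is
`12 + 77/10 + ∑ i ∈ [12, 20], (1 - 77/(10 i)) + ∑ i ∈ [13, 29], (1 - 12/i) = 30.9491…`. -/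
theorem sum_le_of_constraints (z : ℕ → ℝ) (C : ℝ) (hz : ∀ x, 0 ≤ z x) (hC : 0 ≤ C)
    (h₁ : ∀ x ∈ Finset.Ico (60 : ℕ) 69, (80 - (x : ℝ)) * z x ≤ C)
    (h₂ : ∀ x ∈ Finset.Ico (91 : ℕ) 120, (120 - (x : ℝ)) * z x ≤ C)
    (hu : ∀ x ∈ Finset.Ico 9 20, ∑ p ∈ Finset.Ico (60 : ℕ) 69, z p + 40 * z x ≤ C)
    (hw : ∑ x ∈ Finset.Ico 9 20, z x + ∑ x ∈ Finset.Ico (91 : ℕ) 120, z x ≤ C) :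
    ∑ x ∈ Finset.Ico 9 20, 40 * z x + (∑ x ∈ Finset.Ico (60 : ℕ) 69, (80 - (x : ℝ)) * z x +
      ∑ x ∈ Finset.Ico (91 : ℕ) 120, (120 - (x : ℝ)) * z x) ≤ C * 30.95 := by
  have hu' := Finset.sum_le_sum hu
  rw [Finset.sum_add_distrib, Finset.sum_const, Finset.sum_const, Nat.card_Ico,
    ← Finset.mul_sum, nsmul_eq_mul, nsmul_eq_mul] at hu'
  have e₁ : ∑ x ∈ Finset.Ico (60 : ℕ) 69, ((80 - (x : ℝ)) * z x - 77 / 10 * z x) ≤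
      ∑ x ∈ Finset.Ico (60 : ℕ) 69, (1 - 77 / 10 / (80 - (x : ℝ))) * C := by
    refine Finset.sum_le_sum fun x hx => ?_
    have hx' := h₁ x hx
    rw [Finset.mem_Ico] at hx
    have hlt : (x : ℝ) ≤ 68 := by exact_mod_cast Nat.lt_succ_iff.1 hx.2
    have hpos : (0 : ℝ) < 80 - x := by linarith
    have hnn : 0 ≤ 1 - 77 / 10 / (80 - (x : ℝ)) := by
      rw [sub_nonneg, div_le_one hpos]
      linarith
    calc (80 - (x : ℝ)) * z x - 77 / 10 * z x
        = (1 - 77 / 10 / (80 - (x : ℝ))) * ((80 - (x : ℝ)) * z x) := by field_simp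
      _ ≤ _ := mul_le_mul_of_nonneg_left hx' hnn
  have e₂ : ∑ x ∈ Finset.Ico (91 : ℕ) 120, ((120 - (x : ℝ)) * z x - 12 * z x) ≤
      ∑ x ∈ Finset.Ico (91 : ℕ) 120, (if x < 108 then 1 - 12 / (120 - (x : ℝ)) else 0) * C := by
    refine Finset.sum_le_sum fun x hx => ?_
    have hx' := h₂ x hx
    rw [Finset.mem_Ico] at hx
    split_ifs with hlt
    · have hlt' : (x : ℝ) ≤ 108 := by exact_mod_cast hlt.le
      have hpos : (0 : ℝ) < 120 - x := by linarith
      have hnn : 0 ≤ 1 - 12 / (120 - (x : ℝ)) := by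
        rw [sub_nonneg, div_le_one hpos]
        linarith
      calc (120 - (x : ℝ)) * z x - 12 * z x
          = (1 - 12 / (120 - (x : ℝ))) * ((120 - (x : ℝ)) * z x) := by field_simp
        _ ≤ _ := mul_le_mul_of_nonneg_left hx' hnn
    -- for these `x` the coefficient `108 - x` is not positive
    · have hle : (108 : ℝ) ≤ x := by exact_mod_cast not_lt.1 hlt
      nlinarith [hz x]
  rw [← Finset.sum_mul, Finset.sum_sub_distrib, ← Finset.mul_sum] at e₁ e₂
  have v₁ : ∑ x ∈ Finset.Ico (60 : ℕ) 69, (1 - 77 / 10 / (80 - (x : ℝ))) +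
      ∑ x ∈ Finset.Ico (91 : ℕ) 120, (if x < 108 then 1 - 12 / (120 - (x : ℝ)) else 0) ≤ 11.25 := by
    rw [Finset.sum_Ico_eq_sum_range, Finset.sum_Ico_eq_sum_range]
    norm_num [Finset.sum_range_succ]
  rw [← Finset.mul_sum]
  push_cast at hu'
  nlinarith [mul_le_mul_of_nonneg_right v₁ hC]

theorem sum_card_renamedOutput_le_mul (d : DetAlgorithm) :
    ∑ σ ∈ renamings, ((renamedOutput d σ).card : ℝ) ≤ renamings.card * (30.95 : ℝ) := by
  have htot := sum_card_renamedOutput_le d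
  rw [Finset.sum_congr rfl fun x hx => sum_matchCount_candidates d (lastCandidate_mem hx),
    servers, Finset.sum_union (by
      rw [Finset.disjoint_left]; intro y; simp only [Finset.mem_union, Finset.mem_Ico]; omega),
    Finset.sum_union (by
      rw [Finset.disjoint_left]; intro y; simp only [Finset.mem_Ico]; omega)] at htot
  let z : ℕ → ℝ := fun x => matchCount d x (lastCandidate x)
  have c₀ : ∀ x ∈ Finset.Ico 9 20, ((candidates x).card : ℝ) = 40 := by
    intro x hx
    rw [Finset.mem_Ico] at hx
    rw [candidates_of_lt_twenty hx.1 hx.2, Nat.card_Ico]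
    norm_num
  have c₁ : ∀ x ∈ Finset.Ico 60 69, ((candidates x).card : ℝ) = 80 - x := by
    intro x hx
    rw [Finset.mem_Ico] at hx
    rw [candidates_of_lt_sixty_nine hx.1 hx.2, Nat.card_Ico, Nat.cast_sub (by omega),
      Nat.cast_sub hx.1]
    push_cast
    ring
  have c₂ : ∀ x ∈ Finset.Ico 91 120, ((candidates x).card : ℝ) = 120 - x := by
    intro x hx
    rw [Finset.mem_Ico] at hx
    rw [candidates_of_ninety_one_le hx.1, Nat.card_Ico, Nat.cast_sub (by omega),
      Nat.cast_sub (by omega)]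
    push_cast
    ring
  have hs : ∀ x ∈ servers, ((candidates x).card : ℝ) * z x ≤ renamings.card := fun x hx => by
    simp only [z]
    exact_mod_cast matchCount_constraint_server d hx
  have hbound := sum_le_of_constraints z renamings.card (fun _ => Nat.cast_nonneg _)
    (Nat.cast_nonneg _)
    (fun x hx => by
      rw [← c₁ x hx]
      exact hs x (by simp only [servers, Finset.mem_union]; exact Or.inr (Or.inl hx)))
    (fun x hx => by
      rw [← c₂ x hx]
      exact hs x (by simp only [servers, Finset.mem_union]; exact Or.inr (Or.inr hx)))
    (fun x hx => by
      rw [Finset.mem_Ico] at hx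
      simp only [z]
      exact_mod_cast matchCount_constraint_first_block d hx.1 hx.2)
    (by simp only [z]; exact_mod_cast matchCount_constraint_second_block d)
  have e₀ : ∑ x ∈ Finset.Ico 9 20, ((candidates x).card : ℝ) * z x =
      ∑ x ∈ Finset.Ico 9 20, 40 * z x :=
    Finset.sum_congr rfl fun x hx => by rw [c₀ x hx]
  have e₁ : ∑ x ∈ Finset.Ico 60 69, ((candidates x).card : ℝ) * z x =
      ∑ x ∈ Finset.Ico (60 : ℕ) 69, (80 - (x : ℝ)) * z x :=
    Finset.sum_congr rfl fun x hx => by rw [c₁ x hx]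
  have e₂ : ∑ x ∈ Finset.Ico 91 120, ((candidates x).card : ℝ) * z x =
      ∑ x ∈ Finset.Ico (91 : ℕ) 120, (120 - (x : ℝ)) * z x :=
    Finset.sum_congr rfl fun x hx => by rw [c₂ x hx]
  rw [← e₀, ← e₁, ← e₂] at hbound
  refine le_trans ?_ hbound
  simp only [z]
  exact_mod_cast htot

theorem RandomizedAlgorithm.IsCompetitive.le {Ω : Type*} [MeasurableSpace Ω]
    {A : RandomizedAlgorithm Ω} {c : ℝ} (hA : A.IsCompetitive c) : c ≤ 0.6317 := by
  obtain ⟨σ, -, hσ⟩ := exists_expectedSize_le A renamings.attach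
    (Finset.attach_nonempty_iff.2 ⟨1, one_mem_renamings⟩)
    (fun σ => hardInstance σ.1 (mem_renamings.1 σ.2)) 30.95 fun d => by
      rw [Finset.card_attach]
      refine le_trans (le_of_eq ?_) (sum_card_renamedOutput_le_mul d)
      exact Finset.sum_attach renamings fun σ => ((renamedOutput d σ).card : ℝ)
  have h := (hA (hardInstance σ.1 (mem_renamings.1 σ.2)) isBipartite_renamedGraph).trans hσ
  have hopt : (49 : ℝ) ≤ (hardInstance σ.1 (mem_renamings.1 σ.2)).opt := by
    exact_mod_cast le_opt_hardInstance (mem_renamings.1 σ.2)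
  by_contra! hc
  nlinarith

/-! ### The constants -/

theorem exp_neg_eight_ninths_bounds :
    0.4111 < Real.exp (-(8 / 9)) ∧ Real.exp (-(8 / 9)) < 0.41113 := by
  have h := Real.exp_bound (x := -(8 / 9)) (by norm_num [abs_le]) (n := 10) (by norm_num)
  rw [abs_le] at h
  norm_num [Finset.sum_range_succ, Nat.factorial, abs_of_pos] at h
  constructor <;> norm_num <;> linarith [h.1, h.2]

theorem mainTheorem3 :
    (∀ (Ω : Type*) [MeasurableSpace Ω] (A : RandomizedAlgorithm Ω) (c : ℝ),
      A.IsCompetitive c → c ≤ 0.6317) ∧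
    (0.6317 : ℝ) < 62 / 63 - 6 / 7 * Real.exp (-(8 / 9)) ∧
    62 / 63 - 6 / 7 * Real.exp (-(8 / 9)) < 1 - 1 / Real.exp 1 := by
  obtain ⟨hlo, hhi⟩ := exp_neg_eight_ninths_bounds
  refine ⟨fun Ω _ A c hA => hA.le, ?_, ?_⟩
  · norm_num at hhi ⊢
    linarith
  · have he : 1 / Real.exp 1 < 0.3679 := by
      rw [div_lt_iff₀ (Real.exp_pos 1)]
      have := Real.exp_one_gt_d9
      norm_num at this ⊢
      linarith
    norm_num at hlo he ⊢
    linarith
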